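/- Let $H(\mathbb C)$ be the algebra of entire functions with the compact-open topology and let $D$ be complex differentiation on $H(\mathbb C)$. For an entire function $\Phi(z)=\sum_{n\ge 0}a_nz^n$ of exponential type (i.e. $|a_n|\le M R^n/n!$ for all $n\ge 0$, for some $M,R>0$), $\Phi(D)$ denotes the continuous linear operator $f\mapsto\sum_{n\ge 0}a_nD^nf$ on $H(\mathbb C)$, the series converging in $H(\mathbb C)$. An operator $T$ on $H(\mathbb C)$ supports a hypercyclic algebra if there is a nonzero (not necessarily unital) complex subalgebra $A\subseteq H(\mathbb C)$ such that for every $f\in A\setminus\{0\}$ the orbit $\{f,Tf,T^2f,\dots\}$ is dense in $H(\mathbb C)$. (1) For every complex number $a\neq 0$, the functions $z\mapsto\cos(az)$ and $z\mapsto\sin(az)$ are of exponential type, and both operators $\cos(aD)$ and $\sin(aD)$ support a hypercyclic algebra on $H(\mathbb C)$. (2) The function $x\mapsto\sinh^{-1}(\sin x)$ is strictly concave on $[0,\pi]$. Its graph $\Gamma=\{x+i\sinh^{-1}(\sin x):0\le x\le\pi\}$ is contained in $\{z\in\mathbb C:|\cos z|=1\}$, and $|\cos z|<1$ for every $z\in\operatorname{conv}(\Gamma\cup\{0\})\setminus(\Gamma\cup\{0\})$.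 Likewise, the translate $\Gamma_0=\Gamma-\frac{\pi}{2}$ is contained in $\{z\in\mathbb C:|\sin z|=1\}$, and $|\sin z|<1$ for every $z\in\operatorname{conv}(\Gamma_0\cup\{0\})\setminus(\Gamma_0\cup\{0\})$. Here $\operatorname{conv}$ denotes the convex hull. -/

import Mathlib

/-- The algebra `H(ℂ)` of entire functions, as a subalgebra of `C(ℂ, ℂ)`; its topology is the one
induced by the compact-open topology of `C(ℂ, ℂ)`. -/
def entireFunctions : Subalgebra ℂ C(ℂ, ℂ) where
  carrier := {f | Differentiable ℂ (f : ℂ → ℂ)}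
  mul_mem' := fun {f g} hf hg => by
    change Differentiable ℂ (fun z => f z * g z)
    exact Differentiable.fun_mul hf hg
  add_mem' := fun {f g} hf hg => by
    change Differentiable ℂ (fun z => f z + g z)
    exact Differentiable.fun_add hf hg
  algebraMap_mem' := fun c => by
    change Differentiable ℂ (fun _ : ℂ => algebraMap ℂ ℂ c)
    exact differentiable_const _

theorem entireFunctions.differentiable (f : entireFunctions) :
    Differentiable ℂ (f.1 : ℂ → ℂ) := f.2

theorem entireFunctions.differentiable_deriv (f : entireFunctions) :
    Differentiable ℂ (deriv (f.1 : ℂ → ℂ)) :=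
  differentiableOn_univ.mp
    ((differentiableOn_univ.mpr (entireFunctions.differentiable f)).deriv isOpen_univ)

/-- The operator `D` of complex differentiation on `H(ℂ)`. -/
noncomputable def entireFunctions.D : entireFunctions →ₗ[ℂ] entireFunctions where
  toFun f := ⟨⟨deriv (f.1 : ℂ → ℂ), (entireFunctions.differentiable_deriv f).continuous⟩, (entireFunctions.differentiable_deriv f)⟩
  map_add' f g := by
    apply Subtype.ext
    ext z
    exact deriv_add (entireFunctions.differentiable f z) (entireFunctions.differentiable g z)
  map_smul' c f := by
    apply Subtype.ext
    ext z
    exact deriv_const_smul c (entireFunctions.differentiable f z)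

/-- The `n`-th Taylor coefficient of `Φ` at the origin. -/
noncomputable def taylorCoeffAtZero (Φ : ℂ → ℂ) (n : ℕ) : ℂ :=
  iteratedDeriv n Φ 0 / (n.factorial : ℂ)

/-- `Φ` is entire of finite exponential type. -/
def IsOfExponentialType (Φ : ℂ → ℂ) : Prop :=
  Differentiable ℂ Φ ∧ ∃ M > (0 : ℝ), ∃ R > (0 : ℝ), ∀ n : ℕ,
    ‖taylorCoeffAtZero Φ n‖ ≤ M * (R ^ n / (n.factorial : ℝ))

/-- The continuous linear operator `T` on `H(ℂ)` is the convolution operator `Φ(D)`: the entire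
function `Φ(z) = ∑ aₙ zⁿ` is of exponential type and `T f = ∑ aₙ Dⁿ f` for every `f`, with
convergence in `H(ℂ)`. -/
structure IsConvolutionOperator (Φ : ℂ → ℂ) (T : entireFunctions →L[ℂ] entireFunctions) :
    Prop where
  exponentialType : IsOfExponentialType Φ
  hasSum : ∀ f : entireFunctions,
    HasSum (fun n : ℕ => taylorCoeffAtZero Φ n • (entireFunctions.D ^ n) f) (T f)

/-- The operator `Φ(D)` is determined by `Φ`. -/
theorem IsConvolutionOperator.unique {Φ : ℂ → ℂ} {S T : entireFunctions →L[ℂ] entireFunctions}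
    (hS : IsConvolutionOperator Φ S) (hT : IsConvolutionOperator Φ T) : S = T :=
  ContinuousLinearMap.ext fun f => (hS.hasSum f).unique (hT.hasSum f)

/-- `f` is a hypercyclic vector for `T`: the orbit `{f, T f, T² f, …}` is dense. -/
def IsHypercyclicVector (T : entireFunctions →L[ℂ] entireFunctions) (f : entireFunctions) : Prop :=
  Dense (Set.range fun n : ℕ => (T ^ n) f)

/-- `T` supports a hypercyclic algebra: there is a nonzero subalgebra of `H(ℂ)` (not required to
contain the constants) all of whose nonzero elements are hypercyclic for `T`. -/
def SupportsHypercyclicAlgebra (T : entireFunctions →L[ℂ] entireFunctions) : Prop :=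
  ∃ A : NonUnitalSubalgebra ℂ entireFunctions, (∃ f ∈ A, f ≠ 0) ∧
    ∀ f ∈ A, f ≠ 0 → IsHypercyclicVector T f

/-- The graph of `x ↦ sinh⁻¹(sin x)` over `[0, π]`, as a subset of `ℂ`. -/
noncomputable def cosArc : Set ℂ :=
  (fun x : ℝ => (⟨x, Real.arsinh (Real.sin x)⟩ : ℂ)) '' Set.Icc 0 Real.pi

/-- The same graph, translated by `-π/2`. -/
noncomputable def sinArc : Set ℂ :=
  (fun x : ℝ => (⟨x - Real.pi / 2, Real.arsinh (Real.sin x)⟩ : ℂ)) '' Set.Icc 0 Real.pi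

/-!
Translation by `w` is `exp (w D)` (Taylor's formula, `hasSum_translation`), so `cos (a D)` and
`sin (a D)` are combinations of two translations, and `exp (c z)` is an eigenvector of `Φ(D)` with
eigenvalue `Φ c`.

By Baire's theorem (`supportsHypercyclicAlgebra_of_transitive`) a hypercyclic algebra of the form
`{P(f) : P(0) = 0}` exists as soon as, for every `m ≥ 1`, each nonempty open set contains some `f`
such that an iterate `T ^ q` sends `f, …, f ^ (m - 1)` close to `0` and `f ^ m` into a prescribed
open set. Such an `f` is built from exponentials, whose spans are dense once the frequencies
accumulate (`dense_span_expFun`):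
`f = ∑ a_i exp (γ_i z) + ∑ r_l ρ_l ^ q exp (μ_l z / m)` with `ρ_l ^ m = 1 / Φ(μ_l)`.
Here the `γ_i` are small and `μ_l` lies just outside an arc `Γ` of the level set `|Φ| = 1`, where
`|Φ| > 1`. The terms `exp (μ_l z / m) ^ m` are reproduced by `T ^ q` with constant coefficients.
Every other product of exponentials has a frequency close either to a small multiple of a fixed
direction or to a mean of points of `Γ ∪ {0}` that are not all equal. When `|Φ| < 1` there, which
is what the strict convexity of the arc yields, these terms decay geometrically
(`tendsto_iterate_pow_sum_expFun`, `supportsHypercyclicAlgebra_of_arc`).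

For the cosine, `|cos (x + i y)|² = cos² x + sinh² y`, so the part of the level set over `[0, π]`
in the upper half plane is the graph of the strictly concave function `x ↦ arsinh (sin x)`, and
`|cos| < 1` between the graph and the real axis. The strict Jensen inequality supplies the condition
on means (`norm_cos_mean_lt_one`). The sine is a translate of the cosine, and for a general `a` the
arc is replaced by its image under `z ↦ z / a`.
-/

open Filter Topology

/-! ### The Fréchet algebra of entire functions -/

namespace entireFunctions

@[ext]
theorem ext {f g : entireFunctions} (h : ∀ z, f.1 z = g.1 z) : f = g :=
  Subtype.ext (ContinuousMap.ext h)

theorem tendsto_iff {ι : Type*} {l : Filter ι} {F : ι → entireFunctions} {f : entireFunctions} :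
    Tendsto F l (𝓝 f) ↔
      ∀ r : ℝ, TendstoUniformlyOn (fun i z => (F i).1 z) f.1 l (Metric.closedBall 0 r) := by
  rw [tendsto_subtype_rng, ContinuousMap.tendsto_iff_forall_isCompact_tendstoUniformlyOn]
  refine ⟨fun h r => h _ (isCompact_closedBall 0 r), fun h K hK => ?_⟩
  obtain ⟨r, hr⟩ := hK.isBounded.subset_closedBall 0
  exact (h r).mono hr

/-- The Weierstrass M-test on discs. -/
theorem hasSum_of_bound {F : ℕ → entireFunctions} {f : entireFunctions}
    (hF : ∀ z, HasSum (fun n => (F n).1 z) (f.1 z))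
    (hb : ∀ r : ℝ, ∃ u : ℕ → ℝ, Summable u ∧ ∀ n, ∀ z : ℂ, ‖z‖ ≤ r → ‖(F n).1 z‖ ≤ u n) :
    HasSum F f := by
  refine tendsto_iff.2 fun r => ?_
  obtain ⟨u, hu, hle⟩ := hb r
  have h := tendstoUniformlyOn_tsum (f := fun n z => (F n).1 z) hu
    (s := Metric.closedBall 0 r) fun n z hz => hle n z (mem_closedBall_zero_iff.1 hz)
  have e : (fun z => ∑' n, (F n).1 z) = f.1 := funext fun z => (hF z).tsum_eq
  rw [e] at h
  refine h.congr (Eventually.of_forall fun s z _ => ?_)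
  have := map_sum (entireFunctions.val.toLinearMap) F s
  simp only [AlgHom.toLinearMap_apply, Subalgebra.coe_val] at this
  simp [this, ContinuousMap.sum_apply]

instance : IsTopologicalAddGroup entireFunctions :=
  inferInstanceAs (IsTopologicalAddGroup (Subalgebra.toSubmodule entireFunctions).toAddSubgroup)

instance : ContinuousSMul ℂ entireFunctions :=
  inferInstanceAs (ContinuousSMul ℂ (Subalgebra.toSubmodule entireFunctions))

instance : ContinuousMul entireFunctions :=
  inferInstanceAs (ContinuousMul entireFunctions.toSubsemiring.toSubmonoid)

instance : SecondCountableTopology entireFunctions :=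
  TopologicalSpace.Subtype.secondCountableTopology (entireFunctions : Set C(ℂ, ℂ))

/-- A locally uniform limit of entire functions is entire. -/
theorem isClosed_carrier : IsClosed (entireFunctions : Set C(ℂ, ℂ)) := by
  refine isClosed_iff_ultrafilter.2 fun f u hu hmem => ?_
  have h := ContinuousMap.tendsto_iff_tendstoLocallyUniformly.1 (tendsto_id'.2 hu)
  refine differentiableOn_univ.1 ((tendstoLocallyUniformlyOn_univ.2 h).differentiableOn ?_
    isOpen_univ)
  filter_upwards [hmem] with g hg
  exact Differentiable.differentiableOn hg

instance : BaireSpace entireFunctions := by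
  have := isClosed_carrier.isCompletelyPseudoMetrizableSpace
  exact BaireSpace.of_completelyPseudoMetrizable

end entireFunctions

/-! ### A Baire category criterion for hypercyclic algebras -/

open Polynomial in
/-- The non-unital subalgebra of all `P(f)`, where `P` is a polynomial without constant term. -/
noncomputable def polynomialAlgebra (f : entireFunctions) :
    NonUnitalSubalgebra ℂ entireFunctions where
  carrier := {g | ∃ P : ℂ[X], P.coeff 0 = 0 ∧ aeval f P = g}
  add_mem' := by
    rintro _ _ ⟨P, hP, rfl⟩ ⟨Q, hQ, rfl⟩
    exact ⟨P + Q, by simp [hP, hQ], by simp⟩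
  zero_mem' := ⟨0, by simp, by simp⟩
  mul_mem' := by
    rintro _ _ ⟨P, hP, rfl⟩ ⟨Q, hQ, rfl⟩
    exact ⟨P * Q, by simp [Polynomial.mul_coeff_zero, hP], by simp⟩
  smul_mem' := by
    rintro c _ ⟨P, hP, rfl⟩
    exact ⟨c • P, by simp [hP], by simp⟩

open Polynomial in
/-- If along the iterates `q n` the powers of `f` below the `m`-th tend to `0` while the `m`-th
power tends to a prescribed limit, then every polynomial of degree `m` in `f` is hypercyclic: the
leading term dictates the orbit. -/
theorem isHypercyclicVector_aeval {T : entireFunctions →L[ℂ] entireFunctions}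
    {f : entireFunctions} {P : ℂ[X]} (hP0 : P.coeff 0 = 0) (hP : P ≠ 0)
    (h : ∀ m, 0 < m → ∀ v : entireFunctions, ∃ q : ℕ → ℕ,
      (∀ j, 0 < j → j < m → Tendsto (fun n => (T ^ q n) (f ^ j)) atTop (𝓝 0)) ∧
      Tendsto (fun n => (T ^ q n) (f ^ m)) atTop (𝓝 v)) :
    IsHypercyclicVector T (aeval f P) := by
  have hlead : P.coeff P.natDegree ≠ 0 := by simpa using hP
  have hm : 0 < P.natDegree := by
    refine Nat.pos_of_ne_zero fun h0 => hlead ?_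
    rw [h0, hP0]
  intro v
  obtain ⟨q, hlow, htop⟩ := h _ hm ((P.coeff P.natDegree)⁻¹ • v)
  refine mem_closure_of_tendsto (f := fun n => (T ^ q n) (aeval f P)) (b := atTop) ?_
    (Eventually.of_forall fun n => ⟨q n, rfl⟩)
  have e : ∀ n, (T ^ q n) (aeval f P) =
      (∑ i ∈ Finset.range P.natDegree, P.coeff i • (T ^ q n) (f ^ i)) +
        P.coeff P.natDegree • (T ^ q n) (f ^ P.natDegree) := by
    intro n
    rw [aeval_eq_sum_range, Finset.sum_range_succ, map_add, map_sum, map_smul]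
    simp only [map_smul]
  simp only [e]
  have hs : Tendsto (fun n => ∑ i ∈ Finset.range P.natDegree, P.coeff i • (T ^ q n) (f ^ i))
      atTop (𝓝 (∑ i ∈ Finset.range P.natDegree, 0)) := by
    refine tendsto_finsetSum _ fun i hi => ?_
    rcases Nat.eq_zero_or_pos i with rfl | hi0
    · simp [hP0]
    · simpa using (hlow i hi0 (Finset.mem_range.1 hi)).const_smul (P.coeff i)
  have hlim := hs.add (htop.const_smul (P.coeff P.natDegree))
  rwa [Finset.sum_const_zero, zero_add, smul_inv_smul₀ hlead] at hlim

/-- A transitivity-type criterion: it suffices to find, for every degree `m`, an element of a given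
open set whose powers below the `m`-th are sent near `0` by some iterate of `T` that sends the
`m`-th power into another given open set. By Baire's theorem one single `f` then works for all
degrees and all open sets, and the polynomials in `f` without constant term form a hypercyclic
algebra. -/
theorem supportsHypercyclicAlgebra_of_transitive {T : entireFunctions →L[ℂ] entireFunctions}
    (h : ∀ m, 0 < m → ∀ U V W : Set entireFunctions, IsOpen U → U.Nonempty → IsOpen V →
      V.Nonempty → W ∈ 𝓝 0 → ∃ f ∈ U, ∃ q : ℕ,
        (∀ j, 0 < j → j < m → (T ^ q) (f ^ j) ∈ W) ∧ (T ^ q) (f ^ m) ∈ V) :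
    SupportsHypercyclicAlgebra T := by
  set B := TopologicalSpace.countableBasis entireFunctions
  have hB : TopologicalSpace.IsTopologicalBasis B :=
    TopologicalSpace.isBasis_countableBasis entireFunctions
  have : Countable B := (TopologicalSpace.countable_countableBasis entireFunctions).to_subtype
  set G : {m : ℕ // 0 < m} × {V : B // (V : Set entireFunctions).Nonempty} ×
      {W : B // (0 : entireFunctions) ∈ (W : Set entireFunctions)} → Set entireFunctions :=
    fun p => ⋃ q : ℕ, {f | (∀ j ∈ Finset.Ioo 0 p.1.1, (T ^ q) (f ^ j) ∈ p.2.2.1.1) ∧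
      (T ^ q) (f ^ p.1.1) ∈ p.2.1.1.1}
  have hGo : ∀ p, IsOpen (G p) := by
    rintro ⟨m, V, W⟩
    refine isOpen_iUnion fun q => ?_
    refine IsOpen.inter ?_ ((hB.isOpen V.1.2).preimage (by fun_prop))
    have : {f : entireFunctions | ∀ j ∈ Finset.Ioo 0 m.1, (T ^ q) (f ^ j) ∈ W.1.1} =
        ⋂ j ∈ Finset.Ioo 0 m.1, (fun f => (T ^ q) (f ^ j)) ⁻¹' W.1.1 := by
      ext; simp
    change IsOpen {f : entireFunctions | ∀ j ∈ Finset.Ioo 0 m.1, (T ^ q) (f ^ j) ∈ W.1.1}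
    rw [this]
    exact isOpen_biInter_finset fun j _ => (hB.isOpen W.1.2).preimage (by fun_prop)
  have hGd : ∀ p, Dense (G p) := by
    rintro ⟨m, V, W⟩
    refine dense_iff_inter_open.2 fun U hU hUne => ?_
    obtain ⟨f, hf, q, h1, h2⟩ := h m.1 m.2 U V.1.1 W.1.1 hU hUne (hB.isOpen V.1.2) V.2
      ((hB.isOpen W.1.2).mem_nhds W.2)
    refine ⟨f, hf, Set.mem_iUnion.2 ⟨q, fun j hj => ?_, h2⟩⟩
    rw [Finset.mem_Ioo] at hj
    exact h1 j hj.1 hj.2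
  obtain ⟨f, hf⟩ := (dense_iInter_of_isOpen hGo hGd).nonempty
  rw [Set.mem_iInter] at hf
  have key : ∀ m, 0 < m → ∀ v : entireFunctions, ∃ q : ℕ → ℕ,
      (∀ j, 0 < j → j < m → Tendsto (fun n => (T ^ q n) (f ^ j)) atTop (𝓝 0)) ∧
      Tendsto (fun n => (T ^ q n) (f ^ m)) atTop (𝓝 v) := by
    intro m hm v
    obtain ⟨V, hV⟩ := (𝓝 v).exists_antitone_basis
    obtain ⟨W, hW⟩ := (𝓝 (0 : entireFunctions)).exists_antitone_basis
    have : ∀ n, ∃ q, (∀ j ∈ Finset.Ioo 0 m, (T ^ q) (f ^ j) ∈ W n) ∧ (T ^ q) (f ^ m) ∈ V n := by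
      intro n
      obtain ⟨V', hV', hvV', hVV'⟩ := hB.mem_nhds_iff.1 (hV.mem n)
      obtain ⟨W', hW', hwW', hWW'⟩ := hB.mem_nhds_iff.1 (hW.mem n)
      obtain ⟨q, h1, h2⟩ := Set.mem_iUnion.1 (hf ⟨⟨m, hm⟩, ⟨⟨V', hV'⟩, ⟨v, hvV'⟩⟩,
        ⟨⟨W', hW'⟩, hwW'⟩⟩)
      exact ⟨q, fun j hj => hWW' (h1 j hj), hVV' h2⟩
    choose q h1 h2 using this
    exact ⟨q, fun j h0 hj => hW.tendsto fun n => h1 n j (Finset.mem_Ioo.2 ⟨h0, hj⟩),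
      hV.tendsto h2⟩
  refine ⟨polynomialAlgebra f, ⟨f, ⟨Polynomial.X, by simp, by simp⟩, ?_⟩, ?_⟩
  · rintro rfl
    obtain ⟨q, -, h1⟩ := key 1 one_pos 1
    simp only [pow_one, map_zero] at h1
    have h3 : (0 : entireFunctions) = 1 := tendsto_nhds_unique tendsto_const_nhds h1
    exact zero_ne_one (congrArg (fun g : entireFunctions => g.1 0) h3)
  · rintro _ ⟨P, hP0, rfl⟩ hP
    refine isHypercyclicVector_aeval hP0 ?_ key
    rintro rfl
    simp at hP

/-! ### Exponential functions and translations -/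

namespace entireFunctions

/-- The entire function `z ↦ exp (c z)`. -/
noncomputable def expFun (c : ℂ) : entireFunctions :=
  ⟨⟨fun z => Complex.exp (c * z), by fun_prop⟩, by
    change Differentiable ℂ fun z => Complex.exp (c * z)
    fun_prop⟩

@[simp]
theorem expFun_apply (c z : ℂ) : (expFun c).1 z = Complex.exp (c * z) := rfl

@[simp]
theorem smul_apply (c : ℂ) (f : entireFunctions) (z : ℂ) : (c • f).1 z = c * f.1 z := rfl

@[simp]
theorem add_apply (f g : entireFunctions) (z : ℂ) : (f + g).1 z = f.1 z + g.1 z := rfl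

@[simp]
theorem sub_apply (f g : entireFunctions) (z : ℂ) : (f - g).1 z = f.1 z - g.1 z := rfl

@[simp]
theorem mul_apply (f g : entireFunctions) (z : ℂ) : (f * g).1 z = f.1 z * g.1 z := rfl

@[simp]
theorem pow_apply (f : entireFunctions) (n : ℕ) (z : ℂ) : (f ^ n).1 z = f.1 z ^ n := rfl

@[simp]
theorem sum_apply {ι : Type*} (s : Finset ι) (F : ι → entireFunctions) (z : ℂ) :
    (∑ i ∈ s, F i).1 z = ∑ i ∈ s, (F i).1 z := by
  have h := map_sum entireFunctions.val.toLinearMap F s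
  simp only [AlgHom.toLinearMap_apply, Subalgebra.coe_val] at h
  simp [h, ContinuousMap.sum_apply]

theorem expFun_zero : expFun 0 = 1 := by
  ext z
  simp

theorem expFun_add (c d : ℂ) : expFun (c + d) = expFun c * expFun d := by
  ext z
  simp [add_mul, Complex.exp_add]

theorem prod_expFun {ι : Type*} (s : Finset ι) (c : ι → ℂ) :
    ∏ i ∈ s, expFun (c i) = expFun (∑ i ∈ s, c i) := by
  classical
  induction s using Finset.induction_on with
  | empty => simp [expFun_zero]
  | insert i s hi ih => rw [Finset.prod_insert hi, Finset.sum_insert hi, ih, expFun_add]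

theorem continuous_expFun : Continuous expFun := by
  refine Continuous.subtype_mk (f := fun c => (expFun c).1) ?_ _
  exact ContinuousMap.continuous_of_continuous_uncurry _ (by
    change Continuous fun p : ℂ × ℂ => Complex.exp (p.1 * p.2)
    fun_prop)

/-- The translation operator `f ↦ f(· + w)`. -/
noncomputable def translation (w : ℂ) : entireFunctions →L[ℂ] entireFunctions where
  toFun f := ⟨f.1.comp ⟨fun z => z + w, by fun_prop⟩,
    (entireFunctions.differentiable f).comp (differentiable_id.add_const w)⟩
  map_add' _ _ := rfl
  map_smul' _ _ := rfl
  cont := (Continuous.subtype_mk ((ContinuousMap.continuous_precomp _).comp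
    continuous_subtype_val) _)

@[simp]
theorem translation_apply (w z : ℂ) (f : entireFunctions) :
    (translation w f).1 z = f.1 (z + w) := rfl

theorem translation_expFun (w c : ℂ) :
    translation w (expFun c) = Complex.exp (c * w) • expFun c := by
  ext z
  simp [mul_add, Complex.exp_add, mul_comm]

theorem D_pow_apply (f : entireFunctions) (n : ℕ) (z : ℂ) :
    ((D ^ n) f).1 z = iteratedDeriv n f.1 z := by
  induction n generalizing z with
  | zero => simp
  | succ n ih =>
    rw [pow_succ', iteratedDeriv_succ]
    change deriv ((D ^ n) f).1 z = _
    exact congrArg (fun g => deriv g z) (funext ih)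

/-- Taylor's formula as an identity between operators: translation by `w` is `exp (w D)`. The
convergence is uniform on each disc by Cauchy's estimates on a disc larger by `2 ‖w‖ + 1`. -/
theorem hasSum_translation (w : ℂ) (f : entireFunctions) :
    HasSum (fun n : ℕ => (w ^ n / (n.factorial : ℂ)) • (D ^ n) f) (translation w f) := by
  refine hasSum_of_bound (fun z => ?_) fun r => ?_
  · have h := Complex.hasSum_taylorSeries_of_entire (entireFunctions.differentiable f) z (z + w)
    rw [add_sub_cancel_left] at h
    refine h.congr_fun fun n => ?_
    rw [smul_apply, D_pow_apply, smul_eq_mul, smul_eq_mul, div_eq_inv_mul, mul_assoc]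
  · set ρ : ℝ := 2 * ‖w‖ + 1
    have hρ : 0 < ρ := by positivity
    obtain ⟨M, hM⟩ := (isCompact_closedBall (0 : ℂ) (r + ρ)).exists_bound_of_continuousOn
      f.1.continuous.continuousOn
    refine ⟨fun n => M * (‖w‖ / ρ) ^ n, ?_, fun n z hz => ?_⟩
    · refine (summable_geometric_of_lt_one (by positivity) ?_).mul_left M
      rw [div_lt_one hρ]
      have := norm_nonneg w
      linarith
    · have h := Complex.norm_iteratedDeriv_le_of_forall_mem_sphere_norm_le n hρ
        (c := z) (f := f.1) (C := M) (entireFunctions.differentiable f).diffContOnCl (by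
          intro y hy
          refine hM y ?_
          rw [mem_closedBall_zero_iff]
          have h1 : ‖y - z‖ = ρ := by simpa using hy
          have := norm_le_norm_add_norm_sub' y z
          linarith)
      rw [smul_apply, norm_mul, D_pow_apply, norm_div, norm_pow, Complex.norm_natCast]
      calc ‖w‖ ^ n / n.factorial * ‖iteratedDeriv n f.1 z‖
          ≤ ‖w‖ ^ n / n.factorial * (n.factorial * M / ρ ^ n) := by gcongr
        _ = M * (‖w‖ / ρ) ^ n := by
          rw [div_pow]
          field_simp

/-- The coordinate function `z ↦ z`. -/
noncomputable def coord : entireFunctions :=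
  ⟨⟨fun z => z, continuous_id⟩, differentiable_id⟩

@[simp]
theorem coord_apply (z : ℂ) : coord.1 z = z := rfl

/-- Taylor's formula at the origin, as a series converging in the space of entire functions. -/
theorem hasSum_taylor (f : entireFunctions) :
    HasSum (fun n => taylorCoeffAtZero f.1 n • coord ^ n) f := by
  have hs : ∀ z, HasSum (fun n => taylorCoeffAtZero f.1 n * z ^ n) (f.1 z) := by
    intro z
    have h := Complex.hasSum_taylorSeries_of_entire (entireFunctions.differentiable f) 0 z
    rw [sub_zero] at h
    refine h.congr_fun fun n => ?_
    rw [taylorCoeffAtZero, smul_eq_mul, smul_eq_mul]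
    ring
  refine hasSum_of_bound hs fun r => ?_
  refine ⟨_, (hs (|r| : ℝ)).summable.norm, fun n z hz => ?_⟩
  rw [smul_apply, norm_mul, norm_mul, pow_apply, norm_pow, norm_pow]
  gcongr
  rw [Complex.norm_real]
  change ‖z‖ ≤ _
  simpa using hz.trans (le_abs_self r)

theorem tendsto_of_bound {ι : Type*} {l : Filter ι} {F : ι → entireFunctions}
    {f : entireFunctions} (h : ∀ r : ℝ, 0 ≤ r → ∃ u : ι → ℝ, Tendsto u l (𝓝 0) ∧
      ∀ᶠ i in l, ∀ z : ℂ, ‖z‖ ≤ r → ‖(F i).1 z - f.1 z‖ ≤ u i) :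
    Tendsto F l (𝓝 f) := by
  refine tendsto_iff.2 fun r => Metric.tendstoUniformlyOn_iff.2 fun ε hε => ?_
  obtain ⟨u, hu, hle⟩ := h |r| (abs_nonneg r)
  filter_upwards [hle, hu.eventually_lt_const hε] with i h1 h2 z hz
  rw [dist_comm, dist_eq_norm]
  exact (h1 z ((mem_closedBall_zero_iff.1 hz).trans (le_abs_self r))).trans_lt h2

/-- The `n`-th Taylor remainder of `c ↦ exp (c z)` at `c₀`, divided by `(c - c₀)ⁿ`, tends to
`zⁿ exp (c₀ z) / n!`, locally uniformly in `z`. -/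
theorem tendsto_expFun_remainder (c₀ : ℂ) (n : ℕ) :
    Tendsto (fun c => ((c - c₀) ^ n)⁻¹ • (expFun c -
        ∑ j ∈ Finset.range n, ((c - c₀) ^ j / (j.factorial : ℂ)) • (coord ^ j * expFun c₀)))
      (𝓝[≠] c₀) (𝓝 ((n.factorial : ℂ)⁻¹ • (coord ^ n * expFun c₀))) := by
  refine tendsto_of_bound fun r hr => ?_
  refine ⟨fun c => Real.exp (‖c₀‖ * r) * (r ^ (n + 1) * ‖c - c₀‖ * Real.exp (‖c - c₀‖ * r)),
    ?_, ?_⟩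
  · have h : Continuous fun c : ℂ =>
        Real.exp (‖c₀‖ * r) * (r ^ (n + 1) * ‖c - c₀‖ * Real.exp (‖c - c₀‖ * r)) := by fun_prop
    have h' := h.tendsto c₀
    simp only [sub_self, norm_zero, mul_zero, zero_mul] at h'
    exact h'.mono_left nhdsWithin_le_nhds
  · filter_upwards [self_mem_nhdsWithin] with c hc z hz
    set d := c - c₀ with hd
    have hd0 : d ≠ 0 := sub_ne_zero.2 hc
    have hc' : c = c₀ + d := by rw [hd]; ring
    have e : ((d ^ n)⁻¹ • (expFun c -
        ∑ j ∈ Finset.range n, (d ^ j / (j.factorial : ℂ)) • (coord ^ j * expFun c₀))).1 z -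
        ((n.factorial : ℂ)⁻¹ • (coord ^ n * expFun c₀)).1 z =
        Complex.exp (c₀ * z) * ((d ^ n)⁻¹ * (Complex.exp (d * z) -
          ∑ j ∈ Finset.range (n + 1), (d * z) ^ j / (j.factorial : ℂ))) := by
      rw [hc', Finset.sum_range_succ]
      simp only [smul_apply, sub_apply, expFun_apply, sum_apply, mul_apply, pow_apply, coord_apply,
        add_mul, Complex.exp_add, mul_pow]
      have : ∑ j ∈ Finset.range n, d ^ j / (j.factorial : ℂ) * (z ^ j * Complex.exp (c₀ * z)) =
          Complex.exp (c₀ * z) * ∑ j ∈ Finset.range n, d ^ j * z ^ j / (j.factorial : ℂ) := by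
        rw [Finset.mul_sum]
        exact Finset.sum_congr rfl fun j _ => by ring
      rw [this]
      field_simp
      ring
    rw [e, norm_mul, norm_mul, norm_inv, norm_pow]
    have h1 : ‖Complex.exp (c₀ * z)‖ ≤ Real.exp (‖c₀‖ * r) := by
      refine (Complex.norm_exp_le_exp_norm _).trans (Real.exp_le_exp.2 ?_)
      rw [norm_mul]
      gcongr
    have h2 := Complex.norm_exp_sub_sum_le_norm_mul_exp (d * z) (n + 1)
    rw [norm_mul] at h2
    have h3 : (‖d‖ ^ n)⁻¹ * ‖Complex.exp (d * z) -
        ∑ j ∈ Finset.range (n + 1), (d * z) ^ j / (j.factorial : ℂ)‖ ≤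
        r ^ (n + 1) * ‖d‖ * Real.exp (‖d‖ * r) := by
      rw [inv_mul_le_iff₀ (by positivity)]
      refine h2.trans ?_
      calc (‖d‖ * ‖z‖) ^ (n + 1) * Real.exp (‖d‖ * ‖z‖)
          ≤ (‖d‖ * r) ^ (n + 1) * Real.exp (‖d‖ * r) := by gcongr
        _ = _ := by ring
    gcongr

/-- Exponentials whose frequencies accumulate at some point span a dense subspace. The closed span
contains all derivatives of `c ↦ exp (c z)` at the point of accumulation `c₀`, that is all products
of polynomials with `exp (c₀ z)`, and these are dense by Taylor's formula. -/
theorem dense_span_expFun {S : Set ℂ} {c₀ : ℂ} (hS : AccPt c₀ (𝓟 S)) :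
    Dense (Submodule.span ℂ (expFun '' S) : Set entireFunctions) := by
  set M := (Submodule.span ℂ (expFun '' S)).topologicalClosure
  have hMc : IsClosed (M : Set entireFunctions) := Submodule.isClosed_topologicalClosure _
  have hexp : ∀ c ∈ S, expFun c ∈ M := fun c hc =>
    Submodule.le_topologicalClosure _ (Submodule.subset_span ⟨c, hc, rfl⟩)
  have hsub : ∀ {f g : entireFunctions}, f ∈ M → g ∈ M → f - g ∈ M := fun {f g} hf hg => by
    have e : f - g = f + (-1 : ℂ) • g := by
      ext z
      rw [sub_apply, add_apply, smul_apply]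
      ring
    rw [e]
    exact M.add_mem hf (M.smul_mem _ hg)
  have hpow : ∀ n, coord ^ n * expFun c₀ ∈ M := by
    intro n
    induction n using Nat.strong_induction_on with
    | _ n ih =>
      have : NeBot (𝓝[≠] c₀ ⊓ 𝓟 S) := hS
      have h := hMc.mem_of_tendsto ((tendsto_expFun_remainder c₀ n).mono_left
        (inf_le_left : 𝓝[≠] c₀ ⊓ 𝓟 S ≤ _)) (by
          filter_upwards [mem_inf_of_right (mem_principal_self S)] with c hc
          exact M.smul_mem _ (hsub (hexp c hc) (M.sum_mem fun j hj =>
            M.smul_mem _ (ih j (Finset.mem_range.1 hj)))))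
      exact (M.smul_mem_iff (inv_ne_zero (Nat.cast_ne_zero.2 n.factorial_ne_zero))).1 h
  intro f
  have h := (hasSum_taylor (f * expFun (-c₀))).mul_right (expFun c₀)
  rw [mul_assoc, ← expFun_add, neg_add_cancel, expFun_zero, mul_one] at h
  refine hMc.mem_of_tendsto h (Eventually.of_forall fun s => M.sum_mem fun n _ => ?_)
  rw [smul_mul_assoc]
  exact M.smul_mem _ (hpow n)

/-! ### Convolution operators given by translations -/

theorem taylorCoeffAtZero_exp_add_exp (α β w v : ℂ) (n : ℕ) :
    taylorCoeffAtZero (fun z => α * Complex.exp (w * z) + β * Complex.exp (v * z)) n =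
      α * (w ^ n / (n.factorial : ℂ)) + β * (v ^ n / (n.factorial : ℂ)) := by
  have hc : ∀ u : ℂ, ContDiffAt ℂ n (fun z => Complex.exp (u * z)) 0 := fun u => by fun_prop
  rw [taylorCoeffAtZero, iteratedDeriv_fun_add (contDiffAt_const.mul (hc w))
    (contDiffAt_const.mul (hc v)), iteratedDeriv_const_mul _ (hc w),
    iteratedDeriv_const_mul _ (hc v), iteratedDeriv_cexp_const_mul, iteratedDeriv_cexp_const_mul]
  simp
  ring

/-- `α exp (w D) + β exp (v D)` is the corresponding combination of translations. -/
theorem isConvolutionOperator_translation (α β w v : ℂ) :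
    IsConvolutionOperator (fun z => α * Complex.exp (w * z) + β * Complex.exp (v * z))
      (α • translation w + β • translation v) where
  exponentialType := by
    refine ⟨by fun_prop, ‖α‖ + ‖β‖ + 1, by positivity, ‖w‖ + ‖v‖ + 1, by positivity, fun n => ?_⟩
    rw [taylorCoeffAtZero_exp_add_exp]
    have hα : ‖α * (w ^ n / (n.factorial : ℂ))‖ ≤
        ‖α‖ * ((‖w‖ + ‖v‖ + 1) ^ n / (n.factorial : ℝ)) := by
      rw [norm_mul, norm_div, norm_pow, Complex.norm_natCast]
      gcongr
      linarith [norm_nonneg v]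
    have hβ : ‖β * (v ^ n / (n.factorial : ℂ))‖ ≤
        ‖β‖ * ((‖w‖ + ‖v‖ + 1) ^ n / (n.factorial : ℝ)) := by
      rw [norm_mul, norm_div, norm_pow, Complex.norm_natCast]
      gcongr
      linarith [norm_nonneg w]
    have h0 : 0 ≤ (‖w‖ + ‖v‖ + 1) ^ n / (n.factorial : ℝ) := by positivity
    linarith [norm_add_le (α * (w ^ n / (n.factorial : ℂ))) (β * (v ^ n / (n.factorial : ℂ)))]
  hasSum f := by
    have h := ((hasSum_translation w f).const_smul α).add ((hasSum_translation v f).const_smul β)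
    refine h.congr_fun fun n => ?_
    rw [taylorCoeffAtZero_exp_add_exp, add_smul, mul_smul, mul_smul]

end entireFunctions

/-! ### Powers of exponential sums under iteration -/

namespace entireFunctions

theorem iterate_expFun {Φ : ℂ → ℂ} {T : entireFunctions →L[ℂ] entireFunctions}
    (hT : ∀ c, T (expFun c) = Φ c • expFun c) (c : ℂ) (q : ℕ) :
    (T ^ q) (expFun c) = Φ c ^ q • expFun c := by
  induction q with
  | zero => simp
  | succ q ih =>
    rw [pow_succ', mul_apply_eq_comp, ih, map_smul, hT, smul_smul, pow_succ]

theorem iterate_pow_sum_expFun {Φ : ℂ → ℂ} {T : entireFunctions →L[ℂ] entireFunctions}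
    (hT : ∀ c, T (expFun c) = Φ c • expFun c) {ι : Type*} [Fintype ι] (K ρ ν : ι → ℂ) (j q : ℕ) :
    (T ^ q) ((∑ i, (K i * ρ i ^ q) • expFun (ν i)) ^ j) =
      ∑ s : Fin j → ι, ((∏ t, K (s t)) * (Φ (∑ t, ν (s t)) * ∏ t, ρ (s t)) ^ q) •
        expFun (∑ t, ν (s t)) := by
  rw [Fintype.sum_pow, map_sum]
  refine Finset.sum_congr rfl fun s _ => ?_
  rw [Finset.prod_smul, prod_expFun, map_smul, iterate_expFun hT, smul_smul,
    Finset.prod_mul_distrib, Finset.prod_pow]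
  congr 1
  ring

/-- Every nonempty open set contains an exponential sum with frequencies in `S`. -/
theorem exists_sum_expFun_mem {S : Set ℂ} {c₀ : ℂ} (hS : AccPt c₀ (𝓟 S))
    {U : Set entireFunctions} (hU : IsOpen U) (hne : U.Nonempty) :
    ∃ (s : Finset ℂ) (a : ℂ → ℂ), (∀ c ∈ s, c ∈ S) ∧ ∑ c : s, a c • expFun c ∈ U := by
  obtain ⟨f, hfU, hf⟩ := (dense_span_expFun hS).inter_open_nonempty U hU hne
  obtain ⟨l, hl, rfl⟩ := (Finsupp.mem_span_image_iff_linearCombination ℂ).1 hf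
  refine ⟨l.support, l, fun c hc => (Finsupp.mem_supported ℂ l).1 hl hc, ?_⟩
  rw [Finsupp.linearCombination_apply, Finsupp.sum] at hfU
  rwa [Finset.sum_coe_sort l.support fun c => l c • expFun c]

/-- The perturbation `∑ r_l ρ_l ^ q exp (μ_l z)` is chosen so that the `m`-th powers of its
coefficients are exactly undone by the eigenvalues `Φ (m μ_l) ^ q`. In the expansion of
`T ^ q` applied to a power of order at most `m`, every other frequency lies where `|Φ| < 1`, so that
only the pure `m`-th powers survive in the limit. -/
theorem tendsto_iterate_pow_sum_expFun {Φ : ℂ → ℂ} {T : entireFunctions →L[ℂ] entireFunctions}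
    (hT : ∀ c, T (expFun c) = Φ c • expFun c) {A L : Type*} [Fintype A] [Fintype L]
    (a γ : A → ℂ) (r ρ μ : L → ℂ) {m : ℕ} (hm : 0 < m) (hρ : ∀ l, ‖ρ l‖ < 1)
    (hρΦ : ∀ l, ρ l ^ m * Φ (m * μ l) = 1)
    (hΦ : ∀ j, 0 < j → j ≤ m → ∀ s : Fin j → A ⊕ L, ¬ (j = m ∧ ∃ l, ∀ t, s t = Sum.inr l) →
      ‖Φ (∑ t, Sum.elim γ μ (s t))‖ < 1) :
    ∃ f : ℕ → entireFunctions, Tendsto f atTop (𝓝 (∑ i, a i • expFun (γ i))) ∧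
      (∀ j, 0 < j → j < m → Tendsto (fun q => (T ^ q) (f q ^ j)) atTop (𝓝 0)) ∧
      Tendsto (fun q => (T ^ q) (f q ^ m)) atTop (𝓝 (∑ l, r l ^ m • expFun (m * μ l))) := by
  set K : A ⊕ L → ℂ := Sum.elim a r with hK
  set R : A ⊕ L → ℂ := Sum.elim (fun _ => 1) ρ with hR
  set ν : A ⊕ L → ℂ := Sum.elim γ μ with hν
  have hRle : ∀ i, ‖R i‖ ≤ 1 := by
    rintro (i | l)
    · simp [hR]
    · exact (hρ l).le
  -- The terms away from the pure `m`-th powers decay geometrically.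
  have hdecay : ∀ j, 0 < j → j ≤ m → ∀ s : Fin j → A ⊕ L,
      ¬ (j = m ∧ ∃ l, ∀ t, s t = Sum.inr l) →
      Tendsto (fun q : ℕ => ((∏ t, K (s t)) * (Φ (∑ t, ν (s t)) * ∏ t, R (s t)) ^ q) •
        expFun (∑ t, ν (s t))) atTop (𝓝 0) := by
    intro j hj hjm s hs
    have hlt : ‖Φ (∑ t, ν (s t)) * ∏ t, R (s t)‖ < 1 := by
      rw [norm_mul, norm_prod]
      refine (mul_le_of_le_one_right (norm_nonneg _) ?_).trans_lt (hΦ j hj hjm s hs)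
      exact Finset.prod_le_one (fun _ _ => norm_nonneg _) fun _ _ => hRle _
    have h := ((tendsto_pow_atTop_nhds_zero_of_norm_lt_one hlt).const_mul
      (∏ t, K (s t))).smul_const (expFun (∑ t, ν (s t)))
    simpa only [mul_zero, zero_smul] using h
  refine ⟨fun q => ∑ i, (K i * R i ^ q) • expFun (ν i), ?_, fun j hj hjm => ?_, ?_⟩
  · have h1 : ∀ l, Tendsto (fun q => (r l * ρ l ^ q) • expFun (μ l)) atTop (𝓝 0) := by
      intro l
      have h := ((tendsto_pow_atTop_nhds_zero_of_norm_lt_one (hρ l)).const_mul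
        (r l)).smul_const (expFun (μ l))
      simpa only [mul_zero, zero_smul] using h
    have h2 := (tendsto_const_nhds (x := ∑ i, a i • expFun (γ i))).add
      (tendsto_finsetSum Finset.univ fun l _ => h1 l)
    rw [Finset.sum_const_zero, add_zero] at h2
    refine h2.congr fun q => ?_
    rw [Fintype.sum_sum_type]
    simp only [hK, hR, hν, Sum.elim_inl, Sum.elim_inr, one_pow, mul_one]
  · simp only [iterate_pow_sum_expFun hT]
    have h := tendsto_finsetSum Finset.univ fun s (_ : s ∈ Finset.univ) =>
      hdecay j hj hjm.le s fun h => hjm.ne h.1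
    rwa [Finset.sum_const_zero] at h
  · simp only [iterate_pow_sum_expFun hT]
    classical
    let e : L → Fin m → A ⊕ L := fun l _ => Sum.inr l
    have he : Function.Injective e := fun l l' h =>
      Sum.inr_injective (congrFun h ⟨0, hm⟩)
    let G : (Fin m → A ⊕ L) → entireFunctions := fun s =>
      if s ∈ Set.range e then (∏ t, K (s t)) • expFun (∑ t, ν (s t)) else 0
    have hG : ∑ l, r l ^ m • expFun (m * μ l) = ∑ s, G s := by
      refine Fintype.sum_of_injective e he _ G (fun s hs => if_neg hs) fun l => ?_
      simp only [G]
      rw [if_pos ⟨l, rfl⟩]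
      simp [e, hK, hν]
    rw [hG]
    refine tendsto_finsetSum Finset.univ fun s _ => ?_
    by_cases hs : s ∈ Set.range e
    · simp only [G, if_pos hs]
      obtain ⟨l, rfl⟩ := hs
      have h1 : Φ (∑ t, ν (e l t)) * ∏ t, R (e l t) = 1 := by
        simpa [e, hR, hν, mul_comm] using hρΦ l
      simp only [h1, one_pow, mul_one]
      exact tendsto_const_nhds
    · simp only [G, if_neg hs]
      refine hdecay m hm le_rfl s fun h => hs ?_
      obtain ⟨-, l, hl⟩ := h
      exact ⟨l, funext fun t => (hl t).symm⟩

/-! ### The arc criterion -/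

theorem norm_sum_lt_one_of_mean {Φ : ℂ → ℂ} {Γ : Set ℂ}
    (hin : ∀ (m : ℕ) (z : Fin m → ℂ), (∀ i, z i ∈ Γ ∪ {0}) → (∃ i j, z i ≠ z j) →
      ‖Φ (∑ i, (m : ℂ)⁻¹ * z i)‖ < 1)
    {j m : ℕ} (hjm : j ≤ m) (z : Fin j → ℂ) (hz : ∀ i, z i ∈ Γ ∪ {0}) (hne : ∃ t, z t ≠ 0)
    (hnc : j = m → ∃ i i', z i ≠ z i') :
    ‖Φ (∑ i, (m : ℂ)⁻¹ * z i)‖ < 1 := by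
  -- A shorter tuple is padded with zeros.
  obtain ⟨k, rfl⟩ := Nat.exists_eq_add_of_le hjm
  have h := hin (j + k) (Fin.append z fun _ => 0) ?_ ?_
  · simpa [Fin.sum_univ_add] using h
  · intro i
    refine Fin.addCases (fun i => ?_) (fun i => ?_) i
    · simpa using hz i
    · simp
  · obtain ⟨t, ht⟩ := hne
    rcases Nat.eq_zero_or_pos k with hk | hk
    · obtain ⟨i, i', h⟩ := hnc (by omega)
      exact ⟨Fin.castAdd k i, Fin.castAdd k i', by simpa using h⟩
    · exact ⟨Fin.castAdd k t, Fin.natAdd j ⟨0, hk⟩, by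
        rwa [Fin.append_left, Fin.append_right]⟩

/-- If `Φ` has modulus less than one at the mean of every non-constant finite family taken from
`Γ ∪ {0}`, the same holds after small perturbations. Frequencies near `0` are labelled `none`. -/
theorem exists_uniform_perturbation {Φ : ℂ → ℂ} (hΦ : Continuous Φ) {Γ : Set ℂ} (h0 : 0 ∉ Γ)
    (hin : ∀ (m : ℕ) (z : Fin m → ℂ), (∀ i, z i ∈ Γ ∪ {0}) → (∃ i j, z i ≠ z j) →
      ‖Φ (∑ i, (m : ℂ)⁻¹ * z i)‖ < 1)
    (m : ℕ) (L : Finset ℂ) (hL : ∀ p ∈ L, p ∈ Γ) :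
    ∃ δ > 0, ∀ j ≤ m, ∀ u : Fin j → Option L, (∃ t, u t ≠ none) →
      ¬ (j = m ∧ ∃ l, ∀ t, u t = some l) →
      ∀ w : Fin j → ℂ, (∀ t, dist (w t) ((m : ℂ)⁻¹ * (u t).elim 0 Subtype.val) < δ) →
        ‖Φ (∑ t, w t)‖ < 1 := by
  have key : ∀ (j : Fin (m + 1)) (u : Fin j → Option L), ∀ᶠ δ in 𝓝[>] (0 : ℝ),
      (∃ t, u t ≠ none) → ¬ (j.1 = m ∧ ∃ l, ∀ t, u t = some l) →
      ∀ w : Fin j → ℂ, (∀ t, dist (w t) ((m : ℂ)⁻¹ * (u t).elim 0 Subtype.val) < δ) →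
        ‖Φ (∑ t, w t)‖ < 1 := by
    intro j u
    by_cases hu : (∃ t, u t ≠ none) ∧ ¬ (j.1 = m ∧ ∃ l, ∀ t, u t = some l)
    swap
    · exact Eventually.of_forall fun δ h1 h2 => (hu ⟨h1, h2⟩).elim
    obtain ⟨⟨t₀, ht₀⟩, hnc⟩ := hu
    obtain ⟨l, hl⟩ := Option.ne_none_iff_exists'.1 ht₀
    have hlne : (l : ℂ) ≠ 0 := fun h => h0 (h ▸ hL l l.2)
    have hlt : ‖Φ (∑ t, (m : ℂ)⁻¹ * (u t).elim 0 Subtype.val)‖ < 1 := by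
      refine norm_sum_lt_one_of_mean hin (Nat.lt_succ_iff.1 j.2)
        (fun t => (u t).elim 0 Subtype.val) (fun t => ?_) ⟨t₀, by simpa [hl] using hlne⟩
        fun hjm => ?_
      · rcases u t with _ | l'
        · simp
        · exact Or.inl (hL l' l'.2)
      · have : ∃ t, u t ≠ some l := by
          by_contra! hcon
          exact hnc ⟨hjm, l, hcon⟩
        obtain ⟨t, ht⟩ := this
        refine ⟨t₀, t, ?_⟩
        rcases hut : u t with _ | l'
        · simpa [hl] using hlne
        · intro h
          refine ht ?_
          rw [hut, Option.some_inj]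
          simp only [hl, Option.elim_some] at h
          exact Subtype.ext h.symm
    have hcont : Continuous fun w : Fin j → ℂ => ‖Φ (∑ t, w t)‖ := by fun_prop
    obtain ⟨δ₀, hδ₀, hball⟩ := Metric.eventually_nhds_iff.1
      (hcont.continuousAt.eventually_lt_const hlt)
    filter_upwards [Ioo_mem_nhdsGT hδ₀] with δ hδ _ _ w hw
    refine hball ((dist_pi_lt_iff hδ₀).2 fun t => (hw t).trans hδ.2)
  obtain ⟨δ, hδ, hδ0⟩ := ((eventually_all.2 fun j => eventually_all.2 (key j)).and
    self_mem_nhdsWithin).exists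
  exact ⟨δ, hδ0, fun j hj u => hδ ⟨j, Nat.lt_succ_iff.2 hj⟩ u⟩

theorem accPt_zero_segment {v : ℂ} (hv : v ≠ 0) {τ : ℝ} (hτ : 0 < τ) :
    AccPt 0 (𝓟 ((fun t : ℝ => (t : ℂ) * v) '' Set.Ioo (0 : ℝ) τ)) := by
  rw [accPt_iff_frequently]
  have h : Tendsto (fun t : ℝ => (t : ℂ) * v) (𝓝[>] 0) (𝓝 0) := by
    have hc : Continuous fun t : ℝ => (t : ℂ) * v := by fun_prop
    have := hc.tendsto 0
    simp only [Complex.ofReal_zero, zero_mul] at this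
    exact this.mono_left nhdsWithin_le_nhds
  refine h.frequently (Eventually.frequently ?_)
  filter_upwards [Ioo_mem_nhdsGT hτ] with t ht
  exact ⟨mul_ne_zero (Complex.ofReal_ne_zero.2 ht.1.ne') hv, t, ht, rfl⟩

/-- The arc criterion. The set `Γ` plays the role of a strictly convex arc in the level set
`|Φ| = 1`: target functions are approximated by exponentials with frequencies just outside `Γ`,
where `|Φ| > 1`, while the means of distinct points of `Γ ∪ {0}` fall into `|Φ| < 1`. -/
theorem supportsHypercyclicAlgebra_of_arc {Φ : ℂ → ℂ} (hΦ : Continuous Φ)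
    {T : entireFunctions →L[ℂ] entireFunctions} (hT : ∀ c, T (expFun c) = Φ c • expFun c)
    {Γ : Set ℂ} {c₀ : ℂ} (hΓ : AccPt c₀ (𝓟 Γ)) (h0 : 0 ∉ Γ)
    (hout : ∀ p ∈ Γ, p ∈ closure {z | 1 < ‖Φ z‖})
    (hin : ∀ (m : ℕ) (z : Fin m → ℂ), (∀ i, z i ∈ Γ ∪ {0}) → (∃ i j, z i ≠ z j) →
      ‖Φ (∑ i, (m : ℂ)⁻¹ * z i)‖ < 1)
    {v : ℂ} (hv : v ≠ 0) (hsmall : ∀ᶠ t : ℝ in 𝓝[>] 0, ‖Φ ((t : ℂ) * v)‖ < 1) :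
    SupportsHypercyclicAlgebra T := by
  refine supportsHypercyclicAlgebra_of_transitive fun m hm U V W hU hUne hV hVne hW => ?_
  have hm1 : (1 : ℝ) ≤ m := by exact_mod_cast hm
  have hmR : (0 : ℝ) < m := by positivity
  have hmC : (m : ℂ) ≠ 0 := Nat.cast_ne_zero.2 hm.ne'
  obtain ⟨L, β, hL, hβ⟩ := exists_sum_expFun_mem hΓ hV hVne
  -- The frequencies of the target may be moved slightly without leaving `V`.
  have hcont : Continuous fun p : L → ℂ => ∑ l : L, β l • expFun (p l) :=
    continuous_finsetSum _ fun l _ =>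
      (continuous_expFun.comp (continuous_apply (A := fun _ : L => ℂ) l)).const_smul (β l)
  obtain ⟨ε, hε, hεV⟩ := Metric.eventually_nhds_iff.1
    (hcont.continuousAt.eventually (hV.mem_nhds hβ : V ∈ 𝓝 ((fun p : L → ℂ =>
      ∑ l : L, β l • expFun (p l)) Subtype.val)))
  obtain ⟨δ, hδ, hδΦ⟩ := exists_uniform_perturbation hΦ h0 hin m L hL
  obtain ⟨τ, hτ, hτΦ⟩ := mem_nhdsGT_iff_exists_Ioo_subset.1 hsmall
  rw [Set.mem_Ioi] at hτ
  -- The frequencies near `0`: sums of at most `m` of them stay in the segment `(0, τ) v`.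
  have hvn : 0 < ‖v‖ := norm_pos_iff.2 hv
  obtain ⟨A, a, hA, haU⟩ := exists_sum_expFun_mem
    (accPt_zero_segment hv (lt_min (div_pos hτ hmR) (div_pos hδ hvn))) hU hUne
  choose! σ hσ hσA using hA
  -- The perturbed frequencies, just outside the arc.
  have hout' : ∀ l : L, ∃ z, 1 < ‖Φ z‖ ∧ dist z l < min ε δ := fun l => by
    obtain ⟨z, hz, hd⟩ := Metric.mem_closure_iff.1 (hout l (hL l l.2)) _ (lt_min hε hδ)
    exact ⟨z, hz, by rwa [dist_comm]⟩
  choose μ hμ1 hμd using hout'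
  choose r hr using fun l : L => IsAlgClosed.exists_pow_nat_eq (β l) hm
  choose ρ hρ using fun l : L => IsAlgClosed.exists_pow_nat_eq (Φ (μ l))⁻¹ hm
  have hmμ : ∀ l, (m : ℂ) * ((m : ℂ)⁻¹ * μ l) = μ l := fun l => mul_inv_cancel_left₀ hmC _
  have hρ1 : ∀ l, ‖ρ l‖ < 1 := fun l => by
    refine lt_of_pow_lt_pow_left₀ m zero_le_one ?_
    rw [← norm_pow, hρ, norm_inv, one_pow]
    exact inv_lt_one_of_one_lt₀ (hμ1 l)
  have hρΦ : ∀ l, ρ l ^ m * Φ (m * ((m : ℂ)⁻¹ * μ l)) = 1 := fun l => by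
    rw [hρ, hmμ]
    refine inv_mul_cancel₀ fun h => ?_
    have := hμ1 l
    rw [h, norm_zero] at this
    exact absurd this (by norm_num)
  have hlt : ∀ j, 0 < j → j ≤ m → ∀ s : Fin j → A ⊕ L, ¬ (j = m ∧ ∃ l, ∀ t, s t = Sum.inr l) →
      ‖Φ (∑ t, Sum.elim (fun c : A => (c : ℂ)) (fun l => (m : ℂ)⁻¹ * μ l) (s t))‖ < 1 := by
    intro j hj hjm s hs
    by_cases hall : ∃ t l, s t = Sum.inr l
    · refine hδΦ j hjm (fun t => Sum.elim (fun _ => none) some (s t)) ?_ ?_ _ fun t => ?_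
      · obtain ⟨t, l, h⟩ := hall
        exact ⟨t, by simp [h]⟩
      · rintro ⟨h1, l, h2⟩
        refine hs ⟨h1, l, fun t => ?_⟩
        have := h2 t
        rcases hst : s t with c | l' <;> simp_all
      · rcases s t with c | l
        · simp only [Sum.elim_inl, Option.elim_none, mul_zero, dist_zero_right]
          rw [← hσA c c.2, norm_mul, Complex.norm_real, Real.norm_of_nonneg (hσ c c.2).1.le,
            ← lt_div_iff₀ hvn]
          exact (hσ c c.2).2.trans_le (min_le_right _ _)
        · simp only [Sum.elim_inr, Option.elim_some]
          rw [dist_eq_norm, ← mul_sub, norm_mul, norm_inv, Complex.norm_natCast, ← dist_eq_norm]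
          refine (mul_le_of_le_one_left dist_nonneg (inv_le_one_of_one_le₀ hm1)).trans_lt ?_
          exact (hμd l).trans_le (min_le_right _ _)
    · have hs' : ∀ t, ∃ c : A, s t = Sum.inl c := by
        intro t
        rcases hst : s t with c | l
        · exact ⟨c, rfl⟩
        · exact (hall ⟨t, l, hst⟩).elim
      choose c hc using hs'
      have e : ∑ t, Sum.elim (fun c : A => (c : ℂ)) (fun l => (m : ℂ)⁻¹ * μ l) (s t) =
          ((∑ t, σ (c t) : ℝ) : ℂ) * v := by
        rw [Complex.ofReal_sum, Finset.sum_mul]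
        refine Finset.sum_congr rfl fun t _ => ?_
        rw [hc t, Sum.elim_inl]
        exact (hσA (c t) (c t).2).symm
      rw [e]
      have : NeZero j := ⟨hj.ne'⟩
      refine hτΦ ⟨Finset.sum_pos (fun t _ => (hσ (c t) (c t).2).1) Finset.univ_nonempty, ?_⟩
      calc ∑ t, σ (c t) < ∑ _t : Fin j, τ / m :=
            Finset.sum_lt_sum_of_nonempty Finset.univ_nonempty fun t _ =>
              (hσ (c t) (c t).2).2.trans_le (min_le_left _ _)
        _ = j * (τ / m) := by simp
        _ ≤ m * (τ / m) := by gcongr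
        _ = τ := by field_simp
  obtain ⟨f, hf, hlow, htop⟩ := tendsto_iterate_pow_sum_expFun hT (fun c : A => a c)
    (fun c : A => (c : ℂ)) r ρ (fun l => (m : ℂ)⁻¹ * μ l) hm hρ1 hρΦ hlt
  simp only [hmμ, hr] at htop
  have h1 : ∀ᶠ q in atTop, f q ∈ U := hf (hU.mem_nhds haU)
  have h2 : ∀ᶠ q in atTop, ∀ j ∈ Finset.Ioo 0 m, (T ^ q) (f q ^ j) ∈ W :=
    (Finset.eventually_all _).2 fun j hj =>
      hlow j (Finset.mem_Ioo.1 hj).1 (Finset.mem_Ioo.1 hj).2 hW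
  have h3 : ∀ᶠ q in atTop, (T ^ q) (f q ^ m) ∈ V := by
    refine htop (hV.mem_nhds (hεV ((dist_pi_lt_iff hε).2 fun l => ?_)))
    exact (hμd l).trans_le (min_le_left _ _)
  obtain ⟨q, h1, h2, h3⟩ := (h1.and (h2.and h3)).exists
  exact ⟨f q, h1, q, fun j hj hjm => h2 j (Finset.mem_Ioo.2 ⟨hj, hjm⟩), h3⟩

end entireFunctions

/-! ### The level arc of the cosine -/

theorem div_sqrt_two_sub_sq_lt {a b : ℝ} (hb : -1 ≤ b) (hba : b < a) (ha : a ≤ 1) :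
    b / √(2 - b ^ 2) < a / √(2 - a ^ 2) := by
  have hpos : ∀ c : ℝ, -1 ≤ c → c ≤ 1 → 0 < 2 - c ^ 2 := fun c h1 h2 => by nlinarith
  -- By oddness it suffices to treat non-negative arguments.
  have key : ∀ b a : ℝ, 0 ≤ b → b < a → a ≤ 1 → b / √(2 - b ^ 2) < a / √(2 - a ^ 2) := by
    intro b a hb hba ha
    have h1 : 0 < √(2 - a ^ 2) := Real.sqrt_pos.2 (hpos a (by linarith) ha)
    have h2 : √(2 - a ^ 2) ≤ √(2 - b ^ 2) := Real.sqrt_le_sqrt (by nlinarith)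
    exact (div_le_div_of_nonneg_left hb h1 h2).trans_lt (div_lt_div_of_pos_right hba h1)
  rcases le_or_gt 0 b with h0 | h0
  · exact key b a h0 hba ha
  · rcases le_or_gt 0 a with h0' | h0'
    · refine (div_neg_of_neg_of_pos h0 ?_).trans_le (by positivity)
      exact Real.sqrt_pos.2 (hpos b hb (by linarith))
    · have h := key (-a) (-b) (by linarith) (by linarith) (by linarith)
      rw [neg_sq, neg_sq, neg_div, neg_div] at h
      linarith

theorem continuous_arsinh_sin : Continuous fun x => Real.arsinh (Real.sin x) :=
  Real.continuous_arsinh.comp Real.continuous_sin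

theorem strictConcaveOn_arsinh_sin :
    StrictConcaveOn ℝ (Set.Icc 0 Real.pi) (fun x => Real.arsinh (Real.sin x)) := by
  refine StrictAntiOn.strictConcaveOn_of_deriv (convex_Icc _ _)
    continuous_arsinh_sin.continuousOn ?_
  rw [interior_Icc]
  have hd : ∀ x : ℝ, deriv (fun x => Real.arsinh (Real.sin x)) x =
      Real.cos x / √(2 - Real.cos x ^ 2) := by
    intro x
    rw [(Real.hasDerivAt_sin x).arsinh.deriv, smul_eq_mul, inv_mul_eq_div]
    congr 2
    linarith [Real.sin_sq_add_cos_sq x]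
  intro x hx y hy hxy
  rw [hd, hd]
  exact div_sqrt_two_sub_sq_lt (Real.neg_one_le_cos y)
    (Real.cos_lt_cos_of_nonneg_of_le_pi hx.1.le hy.2.le hxy) (Real.cos_le_one x)

theorem arsinh_sin_nonneg {x : ℝ} (hx : x ∈ Set.Icc 0 Real.pi) : 0 ≤ Real.arsinh (Real.sin x) :=
  Real.arsinh_nonneg_iff.2 (Real.sin_nonneg_of_mem_Icc hx)

theorem norm_cos_sq (z : ℂ) :
    ‖Complex.cos z‖ ^ 2 = Real.cos z.re ^ 2 + Real.sinh z.im ^ 2 := by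
  have e : Complex.cos z = ((Real.cos z.re * Real.cosh z.im : ℝ) : ℂ) +
      ((-(Real.sin z.re * Real.sinh z.im) : ℝ) : ℂ) * Complex.I := by
    rw [Complex.cos_eq z]
    push_cast
    ring
  rw [e, Complex.sq_norm, Complex.normSq_add_mul_I]
  have h1 := Real.cosh_sq z.im
  have h2 := Real.sin_sq_add_cos_sq z.re
  linear_combination Real.cos z.re ^ 2 * h1 + Real.sinh z.im ^ 2 * h2

theorem norm_cos_eq_one {z : ℂ} (hz : z.im = Real.arsinh (Real.sin z.re)) :
    ‖Complex.cos z‖ = 1 := by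
  have h := norm_cos_sq z
  rw [hz, Real.sinh_arsinh, Real.cos_sq_add_sin_sq] at h
  exact (pow_eq_one_iff_of_nonneg (norm_nonneg _) two_ne_zero).1 h

theorem norm_cos_lt_one {z : ℂ} (h0 : 0 ≤ z.im) (hz : z.im < Real.arsinh (Real.sin z.re)) :
    ‖Complex.cos z‖ < 1 := by
  have h1 : Real.sinh z.im < Real.sin z.re := by
    rw [← Real.sinh_arsinh (Real.sin z.re)]
    exact Real.sinh_lt_sinh.2 hz
  have h2 : 0 ≤ Real.sinh z.im := Real.sinh_nonneg_iff.2 h0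
  rw [← sq_lt_one_iff₀ (norm_nonneg _), norm_cos_sq, ← Real.cos_sq_add_sin_sq z.re]
  gcongr

theorem one_lt_norm_cos {z : ℂ} (h0 : z.re ∈ Set.Icc 0 Real.pi)
    (hz : Real.arsinh (Real.sin z.re) < z.im) : 1 < ‖Complex.cos z‖ := by
  have h1 : Real.sin z.re < Real.sinh z.im := by
    rw [← Real.sinh_arsinh (Real.sin z.re)]
    exact Real.sinh_lt_sinh.2 hz
  have h2 : 0 ≤ Real.sin z.re := Real.sin_nonneg_of_mem_Icc h0
  rw [← one_lt_sq_iff₀ (norm_nonneg _), norm_cos_sq, ← Real.cos_sq_add_sin_sq z.re]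
  gcongr

/-- The region between the real segment `[0, π]` and the graph of `x ↦ arsinh (sin x)`. -/
def cosRegion : Set ℂ :=
  {z | z.re ∈ Set.Icc 0 Real.pi ∧ 0 ≤ z.im ∧ z.im ≤ Real.arsinh (Real.sin z.re)}

theorem convex_cosRegion : Convex ℝ cosRegion := by
  rintro z ⟨hz1, hz2, hz3⟩ w ⟨hw1, hw2, hw3⟩ s t hs ht hst
  refine ⟨?_, ?_, ?_⟩
  · simpa using convex_Icc 0 Real.pi hz1 hw1 hs ht hst
  · simp only [Complex.add_im, Complex.smul_im, smul_eq_mul]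
    positivity
  · have h := strictConcaveOn_arsinh_sin.concaveOn.2 hz1 hw1 hs ht hst
    simp only [Complex.add_im, Complex.smul_im, Complex.add_re, Complex.smul_re, smul_eq_mul]
      at h ⊢
    refine le_trans ?_ h
    gcongr

theorem ofReal_mem_cosRegion {x : ℝ} (hx : x ∈ Set.Icc 0 Real.pi) : (x : ℂ) ∈ cosRegion :=
  ⟨by simpa using hx, by simp, by simpa using arsinh_sin_nonneg hx⟩

theorem mk_mem_cosRegion {x : ℝ} (hx : x ∈ Set.Icc 0 Real.pi) :
    (⟨x, Real.arsinh (Real.sin x)⟩ : ℂ) ∈ cosRegion :=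
  ⟨hx, arsinh_sin_nonneg hx, le_rfl⟩

/-- Strict Jensen inequality for points of `cosRegion`: the mean of a non-constant family lies
strictly below the graph. -/
theorem norm_cos_mean_lt_one {m : ℕ} {z : Fin m → ℂ} (hz : ∀ i, z i ∈ cosRegion)
    (hne : ∃ i j, z i ≠ z j) : ‖Complex.cos (∑ i, (m : ℂ)⁻¹ * z i)‖ < 1 := by
  obtain ⟨i₀, j₀, hij⟩ := hne
  have hm : (0 : ℝ) < m := Nat.cast_pos.2 i₀.pos
  have e : ∀ i, (m : ℂ)⁻¹ * z i = ((m : ℝ)⁻¹ : ℝ) * z i := fun i => by push_cast; rfl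
  have hre : (∑ i, (m : ℂ)⁻¹ * z i).re = ∑ i, (m : ℝ)⁻¹ • (z i).re := by
    simp only [e, Complex.re_sum, Complex.re_ofReal_mul, smul_eq_mul]
  have him : (∑ i, (m : ℂ)⁻¹ * z i).im = ∑ i, (m : ℝ)⁻¹ • (z i).im := by
    simp only [e, Complex.im_sum, Complex.im_ofReal_mul, smul_eq_mul]
  have hw : ∑ _i : Fin m, (m : ℝ)⁻¹ = 1 := by simp [hm.ne']
  refine norm_cos_lt_one ?_ ?_
  · rw [him]
    exact Finset.sum_nonneg fun i _ => smul_nonneg (by positivity) (hz i).2.1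
  · rw [him, hre]
    by_cases hall : ∀ i, (z i).im = Real.arsinh (Real.sin (z i).re)
    · simp only [hall]
      refine strictConcaveOn_arsinh_sin.lt_map_sum (fun _ _ => by positivity) hw
        (fun i _ => (hz i).1) ⟨i₀, Finset.mem_univ _, j₀, Finset.mem_univ _, fun h => hij ?_⟩
      exact Complex.ext h (by rw [hall, hall, h])
    · push Not at hall
      obtain ⟨k, hk⟩ := hall
      refine lt_of_lt_of_le ?_ (strictConcaveOn_arsinh_sin.concaveOn.le_map_sum
        (fun _ _ => by positivity) hw fun i _ => (hz i).1)
      refine Finset.sum_lt_sum (fun i _ => ?_) ⟨k, Finset.mem_univ _, ?_⟩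
      · exact smul_le_smul_of_nonneg_left (hz i).2.2 (by positivity)
      · exact smul_lt_smul_of_pos_left ((hz k).2.2.lt_of_ne hk) (by positivity)

theorem norm_cos_lt_one_of_mem_cosRegion {z : ℂ} (hz : z ∈ cosRegion) (hz' : z ∉ cosArc) :
    ‖Complex.cos z‖ < 1 :=
  norm_cos_lt_one hz.2.1 (hz.2.2.lt_of_ne fun h => hz' ⟨z.re, hz.1, Complex.ext rfl h.symm⟩)

theorem norm_sin_eq_norm_cos (z : ℂ) :
    ‖Complex.sin z‖ = ‖Complex.cos (z + (Real.pi / 2 : ℝ))‖ := by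
  rw [Complex.ofReal_div, Complex.ofReal_ofNat, Complex.cos_add_pi_div_two, norm_neg]

theorem add_pi_div_two_mem_cosArc {z : ℂ} :
    z + (Real.pi / 2 : ℝ) ∈ cosArc ↔ z ∈ sinArc := by
  constructor
  · rintro ⟨x, hx, h⟩
    refine ⟨x, hx, Complex.ext ?_ ?_⟩
    · have := congrArg Complex.re h
      rw [Complex.add_re, Complex.ofReal_re] at this
      exact sub_eq_of_eq_add this
    · have := congrArg Complex.im h
      rwa [Complex.add_im, Complex.ofReal_im, add_zero] at this
  · rintro ⟨x, hx, rfl⟩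
    exact ⟨x, hx, Complex.ext (by simp) (by simp)⟩

theorem norm_cos_of_mem_cosArc {z : ℂ} (hz : z ∈ cosArc) : ‖Complex.cos z‖ = 1 := by
  obtain ⟨x, -, rfl⟩ := hz
  exact norm_cos_eq_one rfl

theorem cosArc_subset_cosRegion : cosArc ⊆ cosRegion := by
  rintro _ ⟨x, hx, rfl⟩
  exact mk_mem_cosRegion hx

theorem convexHull_cosArc_subset : convexHull ℝ (cosArc ∪ {0}) ⊆ cosRegion := by
  refine convexHull_min (Set.union_subset cosArc_subset_cosRegion ?_) convex_cosRegion
  rw [Set.singleton_subset_iff]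
  exact_mod_cast ofReal_mem_cosRegion ⟨le_rfl, Real.pi_pos.le⟩

theorem convexHull_sinArc_subset :
    convexHull ℝ (sinArc ∪ {0}) ⊆ (fun z => z + ((Real.pi / 2 : ℝ) : ℂ)) ⁻¹' cosRegion := by
  refine convexHull_min (Set.union_subset (fun z hz => ?_) ?_)
    (convex_cosRegion.translate_preimage_left _)
  · exact cosArc_subset_cosRegion (add_pi_div_two_mem_cosArc.2 hz)
  · rw [Set.singleton_subset_iff, Set.mem_preimage, zero_add]
    exact ofReal_mem_cosRegion ⟨by positivity, by linarith [Real.pi_pos]⟩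

/-! ### Hypercyclic algebras for the cosine and the sine of the derivative -/

namespace entireFunctions

/-- Every operator that acts on exponentials through a multiplier of modulus `|cos (a c + b)|`
supports a hypercyclic algebra: the arc criterion applies to the preimage of the graph of
`x ↦ arsinh (sin x)`, without its end points, under `z ↦ a z + b`. -/
theorem supportsHypercyclicAlgebra_of_norm_eq_norm_cos {Φ : ℂ → ℂ} (hΦ : Continuous Φ)
    {T : entireFunctions →L[ℂ] entireFunctions} (hT : ∀ c, T (expFun c) = Φ c • expFun c)
    {a : ℂ} (ha : a ≠ 0) {b : ℝ} (hb : b ∈ Set.Ico 0 Real.pi)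
    (hn : ∀ z, ‖Φ z‖ = ‖Complex.cos (a * z + b)‖) : SupportsHypercyclicAlgebra T := by
  let γ : ℝ → ℂ := fun x => ⟨x, Real.arsinh (Real.sin x)⟩
  have hγ : Continuous γ := by
    have h : γ = fun x : ℝ => (x : ℂ) + (Real.arsinh (Real.sin x) : ℝ) * Complex.I := by
      funext x
      exact (Complex.mk_eq_add_mul_I _ _)
    rw [h]
    exact Complex.continuous_ofReal.add
      ((Complex.continuous_ofReal.comp continuous_arsinh_sin).mul_const _)
  have hcancel : ∀ z : ℂ, a * (a⁻¹ * (z - b)) + b = z := fun z => by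
    rw [mul_inv_cancel_left₀ ha, sub_add_cancel]
  have hbR : (b : ℂ) ∈ cosRegion := ofReal_mem_cosRegion ⟨hb.1, hb.2.le⟩
  refine supportsHypercyclicAlgebra_of_arc hΦ hT
    (Γ := {z | a * z + b ∈ γ '' Set.Ioo 0 Real.pi}) (c₀ := a⁻¹ * (γ (Real.pi / 2) - b))
    (v := a⁻¹) ?_ ?_ ?_ ?_ (inv_ne_zero ha) ?_
  · have hlim : Tendsto (fun x => a⁻¹ * (γ x - b)) (𝓝[≠] (Real.pi / 2))
        (𝓝 (a⁻¹ * (γ (Real.pi / 2) - b))) :=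
      (Continuous.tendsto (by fun_prop) _).mono_left nhdsWithin_le_nhds
    rw [accPt_iff_frequently]
    refine hlim.frequently (Eventually.frequently ?_)
    filter_upwards [self_mem_nhdsWithin, mem_nhdsWithin_of_mem_nhds
      (Ioo_mem_nhds (half_pos Real.pi_pos) (half_lt_self Real.pi_pos))] with x hx hx'
    refine ⟨fun h => hx ?_, x, hx', (hcancel _).symm⟩
    have := sub_left_injective (mul_left_cancel₀ (inv_ne_zero ha) h)
    exact congrArg Complex.re this
  · rintro ⟨x, hx, h⟩
    have h1 := congrArg Complex.im h
    have h2 : 0 < Real.arsinh (Real.sin x) :=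
      Real.arsinh_pos_iff.2 (Real.sin_pos_of_pos_of_lt_pi hx.1 hx.2)
    simp only [γ, mul_zero, zero_add, Complex.ofReal_im] at h1
    exact h2.ne' h1
  · -- Raising a point of the arc slightly leads into the region `|cos| > 1`.
    rintro p ⟨x, hx, h⟩
    have hp : p = a⁻¹ * (γ x + (0 : ℝ) * Complex.I - b) := by
      rw [h]
      simp [ha]
    have hlim : Tendsto (fun t : ℝ => a⁻¹ * (γ x + t * Complex.I - b)) (𝓝[>] 0) (𝓝 p) := by
      rw [hp]
      exact (Continuous.tendsto (by fun_prop) _).mono_left nhdsWithin_le_nhds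
    refine mem_closure_of_tendsto hlim ?_
    filter_upwards [self_mem_nhdsWithin] with t ht
    rw [hn, hcancel]
    rw [Set.mem_Ioi] at ht
    exact one_lt_norm_cos (by simpa [γ] using ⟨hx.1.le, hx.2.le⟩) (by simpa [γ] using ht)
  · intro m z hz hne
    have hm : (m : ℂ) ≠ 0 := Nat.cast_ne_zero.2 hne.choose.pos.ne'
    have e : a * ∑ i, (m : ℂ)⁻¹ * z i + b = ∑ i, (m : ℂ)⁻¹ * (a * z i + b) := by
      simp only [mul_add, Finset.sum_add_distrib, Finset.mul_sum]
      simp [hm, mul_left_comm]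
    rw [hn, e]
    refine norm_cos_mean_lt_one (fun i => ?_) ?_
    · rcases hz i with ⟨x, hx, h⟩ | h
      · rw [← h]
        exact mk_mem_cosRegion ⟨hx.1.le, hx.2.le⟩
      · rw [Set.mem_singleton_iff.1 h, mul_zero, zero_add]
        exact hbR
    · obtain ⟨i, j, hij⟩ := hne
      exact ⟨i, j, fun h => hij (mul_left_cancel₀ ha (add_right_cancel h))⟩
  · filter_upwards [Ioo_mem_nhdsGT (sub_pos.2 hb.2)] with t ht
    have e : a * (t * a⁻¹) + b = ((t + b : ℝ) : ℂ) := by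
      rw [mul_left_comm, mul_inv_cancel₀ ha]
      push_cast
      ring
    rw [hn, e]
    refine norm_cos_lt_one (by simp) ?_
    rw [Complex.ofReal_im, Complex.ofReal_re]
    exact Real.arsinh_pos_iff.2 (Real.sin_pos_of_pos_of_lt_pi (by linarith [ht.1, hb.1])
      (by linarith [ht.2]))

theorem combination_translation_expFun (α β w v c : ℂ) :
    (α • translation w + β • translation v) (expFun c) =
      (α * Complex.exp (w * c) + β * Complex.exp (v * c)) • expFun c := by
  change α • translation w (expFun c) + β • translation v (expFun c) = _
  rw [translation_expFun, translation_expFun, smul_smul, smul_smul, ← add_smul, mul_comm c w,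
    mul_comm c v]

end entireFunctions

open entireFunctions in
theorem exists_convolutionOperator_cos {a : ℂ} (ha : a ≠ 0) :
    ∃ T : entireFunctions →L[ℂ] entireFunctions,
      IsConvolutionOperator (fun z => Complex.cos (a * z)) T ∧ SupportsHypercyclicAlgebra T := by
  have e : (fun z => Complex.cos (a * z)) = fun z =>
      1 / 2 * Complex.exp (a * Complex.I * z) + 1 / 2 * Complex.exp (-(a * Complex.I) * z) := by
    funext z
    rw [Complex.cos]
    ring_nf
  refine ⟨(1 / 2 : ℂ) • translation (a * Complex.I) + (1 / 2 : ℂ) • translation (-(a * Complex.I)),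
    ?_, ?_⟩
  · rw [e]
    exact isConvolutionOperator_translation _ _ _ _
  · refine supportsHypercyclicAlgebra_of_norm_eq_norm_cos (Φ := fun z => Complex.cos (a * z))
      (by fun_prop) (fun c => ?_) ha ⟨le_rfl, Real.pi_pos⟩ fun z => by simp
    rw [combination_translation_expFun]
    exact congrArg (· • expFun c) (congrFun e c).symm

open entireFunctions in
theorem exists_convolutionOperator_sin {a : ℂ} (ha : a ≠ 0) :
    ∃ T : entireFunctions →L[ℂ] entireFunctions,
      IsConvolutionOperator (fun z => Complex.sin (a * z)) T ∧ SupportsHypercyclicAlgebra T := by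
  have e : (fun z => Complex.sin (a * z)) = fun z =>
      -Complex.I / 2 * Complex.exp (a * Complex.I * z) +
        Complex.I / 2 * Complex.exp (-(a * Complex.I) * z) := by
    funext z
    rw [Complex.sin]
    ring_nf
  refine ⟨(-Complex.I / 2) • translation (a * Complex.I) +
    (Complex.I / 2) • translation (-(a * Complex.I)), ?_, ?_⟩
  · rw [e]
    exact isConvolutionOperator_translation _ _ _ _
  · refine supportsHypercyclicAlgebra_of_norm_eq_norm_cos (Φ := fun z => Complex.sin (a * z))
      (by fun_prop) (fun c => ?_) ha
      ⟨(half_pos Real.pi_pos).le, half_lt_self Real.pi_pos⟩ fun z => norm_sin_eq_norm_cos _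
    rw [combination_translation_expFun]
    exact congrArg (· • expFun c) (congrFun e c).symm

theorem mainTheorem3 :
    (∀ a : ℂ, a ≠ 0 →
      (∃ T : entireFunctions →L[ℂ] entireFunctions,
        IsConvolutionOperator (fun z => Complex.cos (a * z)) T ∧ SupportsHypercyclicAlgebra T) ∧
      (∃ T : entireFunctions →L[ℂ] entireFunctions,
        IsConvolutionOperator (fun z => Complex.sin (a * z)) T ∧ SupportsHypercyclicAlgebra T)) ∧
    StrictConcaveOn ℝ (Set.Icc 0 Real.pi) (fun x => Real.arsinh (Real.sin x)) ∧
    (∀ z ∈ cosArc, ‖Complex.cos z‖ = 1) ∧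
    (∀ z ∈ convexHull ℝ (cosArc ∪ {0}) \ (cosArc ∪ {0}), ‖Complex.cos z‖ < 1) ∧
    (∀ z ∈ sinArc, ‖Complex.sin z‖ = 1) ∧
    (∀ z ∈ convexHull ℝ (sinArc ∪ {0}) \ (sinArc ∪ {0}), ‖Complex.sin z‖ < 1) := by
  refine ⟨fun a ha => ⟨exists_convolutionOperator_cos ha, exists_convolutionOperator_sin ha⟩,
    strictConcaveOn_arsinh_sin, fun z hz => norm_cos_of_mem_cosArc hz, fun z hz => ?_,
    fun z hz => ?_, fun z hz => ?_⟩
  · exact norm_cos_lt_one_of_mem_cosRegion (convexHull_cosArc_subset hz.1) fun h =>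
      hz.2 (Or.inl h)
  · rw [norm_sin_eq_norm_cos]
    exact norm_cos_of_mem_cosArc (add_pi_div_two_mem_cosArc.2 hz)
  · rw [norm_sin_eq_norm_cos]
    exact norm_cos_lt_one_of_mem_cosRegion (convexHull_sinArc_subset hz.1) fun h =>
      hz.2 (Or.inl (add_pi_div_two_mem_cosArc.1 h))
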